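/- Let $N\ge 1$, $\lambda\in(-1,1)$, and let $\mathbf C\subset\mathbb R^N$ be a closed convex set with nonempty interior and of class $C^1$, that is, every $x\in\partial\mathbf C$ has an open neighbourhood $U$ and a $C^1$ function $\rho:U\to\mathbb R$ with $\rho(x)=0$, $\nabla\rho(x)\neq0$ and $\mathbf C\cap U=\{y\in U:\rho(y)\le0\}$; let $\nu_{\mathbf C}(x)=\nabla\rho(x)/|\nabla\rho(x)|$ be the outer unit normal to $\partial\mathbf C$ at $x$. Let $K\subset\partial\mathbf C$ be a nonempty compact set and $v:K\to\mathbb R$ a continuous function. For $x\in K$ let $$J_Kv(x)=\{\xi\in\mathbb R^N:\ v(y)-v(x)\ge\xi\cdot(y-x)\ \text{ for all } y\in K\},$$ and put $$\mathcal B^\lambda_v=\bigcup_{x\in K}\{\xi\in J_Kv(x):\ |\xi|<1\ \text{ and }\ \xi\cdot\nu_{\mathbf C}(x)>\lambda\},\qquad B^\lambda=\{\xi\in\mathbb R^N:\ |\xi|<1,\ \xi\cdot e_N>\lambda\}.$$ Then $\mathcal B^\lambda_v$ is a Borel set and its Lebesgue measure satisfies $$|\mathcal B^\lambda_v|\ \ge\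 |B^\lambda|.$$ -/

import Mathlib

/-- `ρ` is a `C¹` defining function of the set `C` on the open neighbourhood `U` of the boundary
point `x`: in `U` the set `C` is the sublevel set `{ρ ≤ 0}`, and `ρ x = 0`, `∇ρ(x) ≠ 0`. -/
structure IsC1DefiningFunction {N : ℕ} (C : Set (EuclideanSpace ℝ (Fin N)))
    (x : EuclideanSpace ℝ (Fin N)) (U : Set (EuclideanSpace ℝ (Fin N)))
    (ρ : EuclideanSpace ℝ (Fin N) → ℝ) : Prop where
  isOpen : IsOpen U
  mem : x ∈ U
  contDiffOn : ContDiffOn ℝ 1 ρ U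
  apply_eq_zero : ρ x = 0
  gradient_ne_zero : gradient ρ x ≠ 0
  mem_iff : ∀ y ∈ U, y ∈ C ↔ ρ y ≤ 0

/-- The set `C` is of class `C¹`: near each of its boundary points it has a `C¹` defining
function. -/
def IsOfClassC1 {N : ℕ} (C : Set (EuclideanSpace ℝ (Fin N))) : Prop :=
  ∀ x ∈ frontier C, ∃ U ρ, IsC1DefiningFunction C x U ρ

/-- `ν` is the outer unit normal to `∂C` at `x`: the normalized gradient of a `C¹` defining
function of `C` near `x`. -/
def IsOuterUnitNormal {N : ℕ} (C : Set (EuclideanSpace ℝ (Fin N)))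
    (x ν : EuclideanSpace ℝ (Fin N)) : Prop :=
  ∃ U ρ, IsC1DefiningFunction C x U ρ ∧ ν = ‖gradient ρ x‖⁻¹ • gradient ρ x

open Classical in
/-- The outer unit normal `ν_C(x)` to `∂C` at `x`. It exists at every boundary point of a set of
class `C¹`, and it is unique by `IsOuterUnitNormal.unique` below, so that the choice made here is
no choice; the value `0` is only used where there is no outer unit normal. -/
noncomputable def outerUnitNormal {N : ℕ} (C : Set (EuclideanSpace ℝ (Fin N)))
    (x : EuclideanSpace ℝ (Fin N)) : EuclideanSpace ℝ (Fin N) :=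
  if h : ∃ ν, IsOuterUnitNormal C x ν then h.choose else 0

/-- The subdifferential `J_Y u(x)` relative to `Y`; it only depends on the values of `u` on
`Y ∪ {x}`, so for `x ∈ Y` a function given on `Y` alone may be extended by any values. -/
def restrictedSubdifferential {N : ℕ} (Y : Set (EuclideanSpace ℝ (Fin N)))
    (u : EuclideanSpace ℝ (Fin N) → ℝ) (x : EuclideanSpace ℝ (Fin N)) :
    Set (EuclideanSpace ℝ (Fin N)) :=
  {ξ | ∀ y ∈ Y, inner ℝ ξ (y - x) ≤ u y - u x}

/-- The union over `x ∈ K` of the sets `{ξ ∈ J_K v(x) : |ξ| < 1, ξ · ν_C(x) > l}`. -/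
def restrictedSubgradients {N : ℕ} (C K : Set (EuclideanSpace ℝ (Fin N)))
    (v : EuclideanSpace ℝ (Fin N) → ℝ) (l : ℝ) : Set (EuclideanSpace ℝ (Fin N)) :=
  ⋃ x ∈ K, {ξ | ξ ∈ restrictedSubdifferential K v x ∧ ‖ξ‖ < 1 ∧
    l < inner ℝ ξ (outerUnitNormal C x)}

/-- The solid spherical cap of the unit ball of `ℝ^N`, `N = n + 1`: the points `x` of the open
unit ball whose last coordinate `x · e_N` is larger than `l`. -/
def sphericalCap (n : ℕ) (l : ℝ) : Set (EuclideanSpace ℝ (Fin (n + 1))) :=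
  {x | ‖x‖ < 1 ∧ l < x (Fin.last n)}

/-- Difference quotients of a defining function along a direction `w`. -/
theorem IsC1DefiningFunction.tendsto_slope {N : ℕ} {C : Set (EuclideanSpace ℝ (Fin N))}
    {x : EuclideanSpace ℝ (Fin N)} {U : Set (EuclideanSpace ℝ (Fin N))}
    {ρ : EuclideanSpace ℝ (Fin N) → ℝ} (h : IsC1DefiningFunction C x U ρ)
    (w : EuclideanSpace ℝ (Fin N)) :
    Filter.Tendsto (fun t : ℝ => ρ (x + t • w) / t) (nhdsWithin (0 : ℝ) (Set.Ioi 0))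
      (nhds (inner ℝ (gradient ρ x) w)) ∧
    ∀ᶠ t in nhdsWithin (0 : ℝ) (Set.Ioi 0), 0 < t ∧ x + t • w ∈ U := by
  have hd : DifferentiableAt ℝ ρ x :=
    (h.contDiffOn.differentiableOn (by norm_num)).differentiableAt (h.isOpen.mem_nhds h.mem)
  have hlim := hd.hasFDerivAt.hasLineDerivAt w
  have hin : inner ℝ (gradient ρ x) w = fderiv ℝ ρ x w := by simp [gradient]
  constructor
  · have hs := hlim.tendsto_slope_zero_right
    rw [hin]
    refine hs.congr (fun t => ?_)
    simp [h.apply_eq_zero, div_eq_inv_mul]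
  · have hcont : Filter.Tendsto (fun t : ℝ => x + t • w) (nhds 0) (nhds x) := by
      have hc : Continuous (fun t : ℝ => x + t • w) := by fun_prop
      simpa using hc.tendsto 0
    have hpos : ∀ᶠ t in nhdsWithin (0 : ℝ) (Set.Ioi 0), 0 < t := self_mem_nhdsWithin
    exact hpos.and
      ((hcont.eventually (h.isOpen.mem_nhds h.mem)).filter_mono nhdsWithin_le_nhds)

/-- The outer unit normal does not depend on the defining function. -/
theorem IsOuterUnitNormal.unique {N : ℕ} {C : Set (EuclideanSpace ℝ (Fin N))}
    {x ν ν' : EuclideanSpace ℝ (Fin N)} (h : IsOuterUnitNormal C x ν)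
    (h' : IsOuterUnitNormal C x ν') : ν = ν' := by
  obtain ⟨U, ρ, hρ, rfl⟩ := h
  obtain ⟨U', ρ', hρ', rfl⟩ := h'
  set a := gradient ρ x with ha
  set b := gradient ρ' x with hb
  have ha0 : 0 < ‖a‖ := norm_pos_iff.2 hρ.gradient_ne_zero
  have hb0 : 0 < ‖b‖ := norm_pos_iff.2 hρ'.gradient_ne_zero
  by_contra hne
  -- the direction `w = b/|b| - a/|a|` enters one sublevel set and leaves the other
  have hlt : inner ℝ a b < ‖a‖ * ‖b‖ := by
    refine inner_lt_norm_mul_iff_real.2 (fun he => hne ?_)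
    have h1 : ‖a‖⁻¹ • ‖b‖⁻¹ • (‖b‖ • a) = ‖a‖⁻¹ • ‖b‖⁻¹ • (‖a‖ • b) := by rw [he]
    rw [inv_smul_smul₀ hb0.ne', smul_comm ‖b‖⁻¹, inv_smul_smul₀ ha0.ne'] at h1
    exact h1
  have hA : inner ℝ a (‖a‖ • b - ‖b‖ • a) < 0 := by
    rw [inner_sub_right, inner_smul_right, inner_smul_right, real_inner_self_eq_norm_sq]
    nlinarith
  have hB : 0 < inner ℝ b (‖a‖ • b - ‖b‖ • a) := by
    rw [inner_sub_right, inner_smul_right, inner_smul_right, real_inner_self_eq_norm_sq,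
      real_inner_comm]
    nlinarith
  have h1 := (hρ.tendsto_slope (‖a‖ • b - ‖b‖ • a)).1.eventually (gt_mem_nhds hA)
  have h2 := (hρ'.tendsto_slope (‖a‖ • b - ‖b‖ • a)).1.eventually (lt_mem_nhds hB)
  obtain ⟨t, ⟨⟨ht1, ht2⟩, htpos, htU⟩, -, htU'⟩ := (((h1.and h2).and
    (hρ.tendsto_slope (‖a‖ • b - ‖b‖ • a)).2).and
    (hρ'.tendsto_slope (‖a‖ • b - ‖b‖ • a)).2).exists
  have hn : ρ (x + t • (‖a‖ • b - ‖b‖ • a)) < 0 := by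
    have := mul_neg_of_neg_of_pos ht1 htpos
    rwa [div_mul_cancel₀ _ htpos.ne'] at this
  have hp : 0 < ρ' (x + t • (‖a‖ • b - ‖b‖ • a)) := by
    have := mul_pos ht2 htpos
    rwa [div_mul_cancel₀ _ htpos.ne'] at this
  exact absurd ((hρ'.mem_iff _ htU').1 ((hρ.mem_iff _ htU).2 hn.le)) (not_le.2 hp)

/-- Any outer unit normal is the one picked in the definition. -/
theorem IsOuterUnitNormal.outerUnitNormal_eq {N : ℕ} {C : Set (EuclideanSpace ℝ (Fin N))}
    {x ν : EuclideanSpace ℝ (Fin N)} (h : IsOuterUnitNormal C x ν) :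
    outerUnitNormal C x = ν := by
  have hex : ∃ ν, IsOuterUnitNormal C x ν := ⟨ν, h⟩
  rw [outerUnitNormal, dif_pos hex]
  exact hex.choose_spec.unique h

/-!
The proof compares both volumes with the integral of one radial density `w`, given by `capWeight`.
It has values in `[0, 1]`, vanishes outside the unit ball, and has on every line with direction `ν`
the mass of the cap about `ν`: the integral of `w` over the line `{z + s ν}`, `z ⟂ ν`, is the length of
`{s > l} ∩ {|z|² + s² < 1}` (`lintegral_capWeight`). This is Archimedes' theorem in disguise: `w ξ`
is the proportion of the circle of radius `√(1 - |ξ|²)` on which a coordinate exceeds `l`, and the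
coordinates of the 2-sphere are uniformly distributed. In particular the integral of `w` over the
whole space is the volume of the cap.

On a half-line `{s ≥ s₀}` of such a line, the mass of `w` is at most the length of the part of the
cap (`setLIntegral_capWeight_le`). Hence a set `A` with `A + t ν ⊆ A` for all `t ≥ 0` satisfies
`∫_A w ≤ |A ∩ {|ξ| < 1, ξ · ν > l}|` (`setLIntegral_capWeight_le_volume_inter`).

For a finite set of points `x_i` of `∂C`, the space is partitioned into the cells of those `ξ` for
which `x_i` is the first minimizer of `v - ξ · id`. Since `C` is convex,
`ν_C(x_i) · (x_j - x_i) ≤ 0`, so the cell of `x_i` is mapped into itself by the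
translations by `t ν_C(x_i)`, `t ≥ 0`. Adding up the estimates for the cells proves the inequality
for finite sets (`volume_sphericalCap_le_of_finite`).

For a general `K`, minimizers over a fine finite net are approximate minimizers over `K`. The sets
of approximate subgradients with `ξ · ν_C(x) ≥ l'` are closed, because `ν_C` is continuous on `∂C`, and
they decrease to the set of exact ones; finally `l'` decreases to `l`. The same closed sets show
that the set in question is Borel.
-/

open MeasureTheory Set Filter Topology
open scoped ENNReal

/-! ### A radial density with the line integrals of a cap -/

/-- The function `d ↦ d ^ (-1/2)` on `d > 0`, extended by `0` to `d ≤ 0`: there `√d = 0`, and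
`0⁻¹ = 0` in `ℝ`. -/
noncomputable def invSqrt (d : ℝ) : ℝ≥0∞ := ENNReal.ofReal (√d)⁻¹

theorem measurable_invSqrt : Measurable invSqrt := by
  unfold invSqrt; fun_prop

theorem invSqrt_of_nonpos {d : ℝ} (hd : d ≤ 0) : invSqrt d = 0 := by
  simp [invSqrt, Real.sqrt_eq_zero_of_nonpos hd]

theorem lintegral_invSqrt_sub_sq_of_nonpos {d : ℝ} (hd : d ≤ 0) :
    ∫⁻ s, invSqrt (d - s ^ 2) = 0 := by
  simp [fun s : ℝ => invSqrt_of_nonpos (show d - s ^ 2 ≤ 0 by nlinarith [sq_nonneg s])]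

/-- The substitution `s = √d sin θ` turns the integrand into `1` on `(-π/2, π/2)`. That the value
does not depend on `d` is what makes `capWeight` work. -/
theorem lintegral_invSqrt_sub_sq {d : ℝ} (hd : 0 < d) :
    ∫⁻ s, invSqrt (d - s ^ 2) = ENNReal.ofReal Real.pi := by
  have hr : 0 < √d := Real.sqrt_pos.2 hd
  have hsq : √d ^ 2 = d := Real.sq_sqrt hd.le
  set S : Set ℝ := Ioo (-(Real.pi / 2)) (Real.pi / 2) with hS
  have hcos : ∀ θ ∈ S, 0 < Real.cos θ := fun θ hθ => Real.cos_pos_of_mem_Ioo hθ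
  -- outside the image of `S` the argument of `invSqrt` is not positive
  have himg : ∀ s : ℝ, s ∉ (fun θ => √d * Real.sin θ) '' S → invSqrt (d - s ^ 2) = 0 := by
    intro s hs
    apply invSqrt_of_nonpos
    by_contra hlt
    have hs1 : (s / √d) ^ 2 < 1 := by
      rw [div_pow, hsq, div_lt_one hd]; linarith
    obtain ⟨h1, h2⟩ := abs_lt.1 ((sq_lt_one_iff_abs_lt_one _).1 hs1)
    refine hs ⟨Real.arcsin (s / √d), ⟨Real.neg_pi_div_two_lt_arcsin.2 h1,
      Real.arcsin_lt_pi_div_two.2 h2⟩, ?_⟩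
    simp only [Real.sin_arcsin h1.le h2.le]
    field_simp
  have hcov := lintegral_image_eq_lintegral_abs_deriv_mul (s := S)
    (f := fun θ => √d * Real.sin θ) (f' := fun θ => √d * Real.cos θ) measurableSet_Ioo
    (fun θ _ => ((Real.hasDerivAt_sin θ).const_mul _).hasDerivWithinAt)
    (fun a ha b hb hab => Real.injOn_sin (Ioo_subset_Icc_self ha) (Ioo_subset_Icc_self hb)
      (mul_left_cancel₀ hr.ne' hab)) (fun s => invSqrt (d - s ^ 2))
  have himgm : MeasurableSet ((fun θ => √d * Real.sin θ) '' S) := by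
    refine measurableSet_Ioo.image_of_continuousOn_injOn (by fun_prop) ?_
    exact fun a ha b hb hab => Real.injOn_sin (Ioo_subset_Icc_self ha) (Ioo_subset_Icc_self hb)
      (mul_left_cancel₀ hr.ne' hab)
  rw [← lintegral_indicator himgm] at hcov
  have hind : ((fun θ => √d * Real.sin θ) '' S).indicator (fun s => invSqrt (d - s ^ 2))
      = fun s => invSqrt (d - s ^ 2) := by
    ext s
    by_cases hs : s ∈ (fun θ => √d * Real.sin θ) '' S
    · rw [indicator_of_mem hs]
    · rw [indicator_of_notMem hs, himg s hs]
  rw [hind] at hcov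
  rw [hcov, setLIntegral_congr_fun (g := fun _ => 1) measurableSet_Ioo]
  · simp
  · intro θ hθ
    have hc := hcos θ hθ
    have h1 : d - (√d * Real.sin θ) ^ 2 = (√d * Real.cos θ) ^ 2 := by
      rw [mul_pow, mul_pow, hsq]; nlinarith [Real.sin_sq_add_cos_sq θ]
    have hp : 0 < √d * Real.cos θ := by positivity
    simp only [h1, invSqrt, Real.sqrt_sq hp.le, abs_of_pos hp]
    rw [← ENNReal.ofReal_mul hp.le, mul_inv_cancel₀ hp.ne', ENNReal.ofReal_one]

/-- The radial density at a point `ξ` of the ball with `|ξ|² = x`. For `x < 1` it is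
`π⁻¹ arccos (l / √(1 - x))`, with the argument of `arccos` truncated to `[-1, 1]`: the proportion of
the circle of radius `√(1 - x)` on which a coordinate exceeds `l`. It vanishes for `x ≥ 1`.
The integral form is kept, because only Tonelli's theorem is applied to it. -/
noncomputable def capWeight (l x : ℝ) : ℝ≥0∞ :=
  (ENNReal.ofReal Real.pi)⁻¹ * ∫⁻ m in Ioi l, invSqrt (1 - x - m ^ 2)

theorem measurable_capWeight (l : ℝ) : Measurable (capWeight l) := by
  unfold capWeight
  refine Measurable.const_mul (Measurable.lintegral_prod_right' (f := fun p : ℝ × ℝ =>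
    invSqrt (1 - p.1 - p.2 ^ 2)) ?_) _
  exact measurable_invSqrt.comp (by fun_prop)

theorem ofReal_pi_inv_mul : (ENNReal.ofReal Real.pi)⁻¹ * ENNReal.ofReal Real.pi = 1 :=
  ENNReal.inv_mul_cancel (by simpa using Real.pi_pos) ENNReal.ofReal_ne_top

theorem capWeight_le (l x : ℝ) : capWeight l x ≤ (Iio (1 : ℝ)).indicator 1 x := by
  have hle : capWeight l x ≤ (ENNReal.ofReal Real.pi)⁻¹ * ∫⁻ m, invSqrt (1 - x - m ^ 2) :=
    mul_le_mul_right (setLIntegral_le_lintegral _ _) _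
  refine hle.trans ?_
  by_cases hx : x < 1
  · rw [lintegral_invSqrt_sub_sq (by linarith), ofReal_pi_inv_mul]
    simp [hx]
  · rw [lintegral_invSqrt_sub_sq_of_nonpos (by linarith)]
    simp

/-- On every line, `capWeight` has the mass of the part of the cap on that line. Here `q` is the
squared distance of the line from the origin, and `s` the position on the line measured from the
foot of the perpendicular. -/
theorem lintegral_capWeight (l q : ℝ) :
    ∫⁻ s, capWeight l (q + s ^ 2) = volume {s : ℝ | l < s ∧ q + s ^ 2 < 1} := by
  have hm : Measurable fun p : ℝ × ℝ => invSqrt (1 - (q + p.1 ^ 2) - p.2 ^ 2) :=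
    measurable_invSqrt.comp (by fun_prop)
  have hS : MeasurableSet {m : ℝ | q + m ^ 2 < 1} := measurableSet_lt (by fun_prop) (by fun_prop)
  have hinner : ∀ m : ℝ, ∫⁻ s, invSqrt (1 - (q + s ^ 2) - m ^ 2)
      = {m : ℝ | q + m ^ 2 < 1}.indicator (fun _ => ENNReal.ofReal Real.pi) m := by
    intro m
    have : ∀ s : ℝ, 1 - (q + s ^ 2) - m ^ 2 = (1 - q - m ^ 2) - s ^ 2 := fun s => by ring
    simp only [this]
    by_cases h : q + m ^ 2 < 1
    · rw [lintegral_invSqrt_sub_sq (by linarith), indicator_of_mem (by exact h)]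
    · rw [lintegral_invSqrt_sub_sq_of_nonpos (by linarith), indicator_of_notMem (by exact h)]
  unfold capWeight
  rw [lintegral_const_mul _ (Measurable.lintegral_prod_right' hm),
    lintegral_lintegral_swap (by exact hm.aemeasurable)]
  simp only [hinner]
  rw [lintegral_indicator hS, setLIntegral_const, ← mul_assoc, ofReal_pi_inv_mul, one_mul,
    Measure.restrict_apply hS]
  congr 1
  ext m; simp [and_comm]

/-- If the half-line `S` contains all of `(l, ∞)`, the right-hand side is the whole mass of
`capWeight` on the line; otherwise `S ⊆ (l, ∞)`, and `capWeight` is at most the indicator function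
of the ball. -/
theorem setLIntegral_capWeight_le (l q : ℝ) {S : Set ℝ} (hup : IsUpperSet S) :
    ∫⁻ s in S, capWeight l (q + s ^ 2) ≤ volume (S ∩ {s : ℝ | l < s ∧ q + s ^ 2 < 1}) := by
  by_cases h : ∃ s ∈ S, s ≤ l
  · obtain ⟨s, hs, hsl⟩ := h
    have : S ∩ {s : ℝ | l < s ∧ q + s ^ 2 < 1} = {s : ℝ | l < s ∧ q + s ^ 2 < 1} :=
      inter_eq_right.2 fun t ht => hup (hsl.trans (le_of_lt (And.left ht))) hs
    rw [this, ← lintegral_capWeight]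
    exact setLIntegral_le_lintegral _ _
  · push Not at h
    have hS : MeasurableSet {m : ℝ | q + m ^ 2 < 1} :=
      measurableSet_lt (by fun_prop) (by fun_prop)
    calc ∫⁻ s in S, capWeight l (q + s ^ 2)
        ≤ ∫⁻ s in S, {m : ℝ | q + m ^ 2 < 1}.indicator 1 s :=
          lintegral_mono fun s => capWeight_le l _
      _ = volume ({m : ℝ | q + m ^ 2 < 1} ∩ S) := by
          rw [lintegral_indicator_one hS, Measure.restrict_apply hS]
      _ ≤ volume (S ∩ {s : ℝ | l < s ∧ q + s ^ 2 < 1}) :=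
          measure_mono fun s hs => ⟨hs.2, h s hs.2, hs.1⟩

/-! ### Sets closed under translation in one direction -/

/-- Tonelli's theorem on the lines parallel to the last coordinate axis. -/
theorem lintegral_eq_lintegral_lintegral_last {n : ℕ} {f : EuclideanSpace ℝ (Fin (n + 1)) → ℝ≥0∞}
    (hf : Measurable f) :
    ∫⁻ x, f x = ∫⁻ z : Fin n → ℝ, ∫⁻ s : ℝ,
      f (WithLp.toLp 2 ((Fin.last n).insertNth (α := fun _ => ℝ) s z)) := by
  have h1 := (PiLp.volume_preserving_toLp (Fin (n + 1))).lintegral_comp hf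
  have h2 := (volume_preserving_piFinSuccAbove (fun _ : Fin (n + 1) => ℝ) (Fin.last n)).symm
  have hm : Measurable fun y : Fin (n + 1) → ℝ => f (WithLp.toLp 2 y) :=
    hf.comp (PiLp.volume_preserving_toLp (Fin (n + 1))).measurable
  have h3 := h2.lintegral_comp hm
  rw [← h1, ← h3, Measure.volume_eq_prod,
    lintegral_prod_symm' _ (by exact hm.comp h2.measurable)]
  rfl

theorem norm_sq_toLp_insertNth {n : ℕ} (s : ℝ) (z : Fin n → ℝ) :
    ‖(WithLp.toLp 2 ((Fin.last n).insertNth (α := fun _ => ℝ) s z) :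
      EuclideanSpace ℝ (Fin (n + 1)))‖ ^ 2 = ∑ i, z i ^ 2 + s ^ 2 := by
  rw [EuclideanSpace.real_norm_sq_eq, Fin.sum_univ_castSucc]
  simp

theorem volume_eq_lintegral_volume_last {n : ℕ} {S : Set (EuclideanSpace ℝ (Fin (n + 1)))}
    (hS : MeasurableSet S) :
    volume S = ∫⁻ z : Fin n → ℝ, volume {s : ℝ |
      WithLp.toLp 2 ((Fin.last n).insertNth (α := fun _ => ℝ) s z) ∈ S} := by
  rw [← lintegral_indicator_one hS,
    lintegral_eq_lintegral_lintegral_last (measurable_one.indicator hS)]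
  refine lintegral_congr fun z => ?_
  have hm : Measurable fun s : ℝ => (WithLp.toLp 2 ((Fin.last n).insertNth (α := fun _ => ℝ) s z) :
      EuclideanSpace ℝ (Fin (n + 1))) := by
    refine (PiLp.volume_preserving_toLp (Fin (n + 1))).measurable.comp (measurable_pi_iff.2 ?_)
    exact (Fin.last n).forall_iff_succAbove.2 ⟨by simpa using measurable_id', fun j => by simp⟩
  exact lintegral_indicator_one (hm hS)

theorem mem_sphericalCap_insertNth {n : ℕ} {l s : ℝ} {z : Fin n → ℝ} :
    (WithLp.toLp 2 ((Fin.last n).insertNth (α := fun _ => ℝ) s z) ∈ sphericalCap n l) ↔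
      l < s ∧ ∑ i, z i ^ 2 + s ^ 2 < 1 := by
  have h := norm_sq_toLp_insertNth s z
  rw [sphericalCap, mem_ofPred_eq, and_comm, ← h, sq_lt_one_iff₀ (norm_nonneg _)]
  simp

theorem measurableSet_sphericalCap (n : ℕ) (l : ℝ) : MeasurableSet (sphericalCap n l) :=
  ((isOpen_lt (by fun_prop) (by fun_prop)).and
    (isOpen_lt (by fun_prop) (by fun_prop))).measurableSet

theorem measurable_capWeight_norm_sq {n : ℕ} (l : ℝ) :
    Measurable fun x : EuclideanSpace ℝ (Fin n) => capWeight l (‖x‖ ^ 2) :=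
  (measurable_capWeight l).comp (by fun_prop)

theorem lintegral_capWeight_norm_sq (n : ℕ) (l : ℝ) :
    ∫⁻ x : EuclideanSpace ℝ (Fin (n + 1)), capWeight l (‖x‖ ^ 2) = volume (sphericalCap n l) := by
  rw [lintegral_eq_lintegral_lintegral_last (measurable_capWeight_norm_sq l),
    volume_eq_lintegral_volume_last (measurableSet_sphericalCap n l)]
  simp only [norm_sq_toLp_insertNth, lintegral_capWeight, mem_sphericalCap_insertNth]

theorem setLIntegral_capWeight_le_volume_inter_sphericalCap {n : ℕ} (l : ℝ)
    {A : Set (EuclideanSpace ℝ (Fin (n + 1)))} (hA : MeasurableSet A)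
    (hup : ∀ x ∈ A, ∀ t : ℝ, 0 ≤ t → x + t • EuclideanSpace.single (Fin.last n) 1 ∈ A) :
    ∫⁻ x in A, capWeight l (‖x‖ ^ 2) ≤ volume (A ∩ sphericalCap n l) := by
  rw [← lintegral_indicator hA, lintegral_eq_lintegral_lintegral_last
      ((measurable_capWeight_norm_sq l).indicator hA),
    volume_eq_lintegral_volume_last (hA.inter (measurableSet_sphericalCap n l))]
  refine lintegral_mono fun z => ?_
  set S : Set ℝ := {s | WithLp.toLp 2 ((Fin.last n).insertNth (α := fun _ => ℝ) s z) ∈ A} with hS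
  have hSup : IsUpperSet S := by
    intro a b hab ha
    have h := hup _ ha (b - a) (sub_nonneg.2 hab)
    rw [hS, mem_ofPred_eq]
    convert h using 1
    ext i
    refine Fin.lastCases ?_ (fun j => ?_) i <;> simp
  refine le_trans (le_of_eq ?_) ((setLIntegral_capWeight_le l (∑ i, z i ^ 2) hSup).trans
    (le_of_eq ?_))
  · rw [← lintegral_indicator hSup.ordConnected.measurableSet]
    refine lintegral_congr fun s => ?_
    by_cases h : s ∈ S
    · rw [indicator_of_mem h, indicator_of_mem (by exact h), norm_sq_toLp_insertNth]
    · rw [indicator_of_notMem h, indicator_of_notMem (by exact h)]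
  · simp only [mem_inter_iff, mem_sphericalCap_insertNth]
    rfl

/-- The reflection that exchanges `e_N` and `ν` reduces this to the case `ν = e_N`. -/
theorem setLIntegral_capWeight_le_volume_inter {n : ℕ} (l : ℝ)
    {A : Set (EuclideanSpace ℝ (Fin (n + 1)))} (hA : MeasurableSet A)
    {ν : EuclideanSpace ℝ (Fin (n + 1))} (hν : ‖ν‖ = 1)
    (hup : ∀ x ∈ A, ∀ t : ℝ, 0 ≤ t → x + t • ν ∈ A) :
    ∫⁻ x in A, capWeight l (‖x‖ ^ 2) ≤ volume (A ∩ {x | ‖x‖ < 1 ∧ l < inner ℝ x ν}) := by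
  set e : EuclideanSpace ℝ (Fin (n + 1)) := EuclideanSpace.single (Fin.last n) 1 with he
  obtain ⟨g, hg⟩ : ∃ g : EuclideanSpace ℝ (Fin (n + 1)) ≃ₗᵢ[ℝ] EuclideanSpace ℝ (Fin (n + 1)),
      g e = ν := ⟨_, Submodule.reflection_sub (v := e) (w := ν) (by simp [he, hν])⟩
  have hgm := g.measurePreserving
  have hge := g.toHomeomorph.measurableEmbedding
  have hcap : MeasurableSet {x : EuclideanSpace ℝ (Fin (n + 1)) | ‖x‖ < 1 ∧ l < inner ℝ x ν} :=
    ((isOpen_lt (by fun_prop) (by fun_prop)).and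
      (isOpen_lt (by fun_prop) (by fun_prop))).measurableSet
  rw [← hgm.setLIntegral_comp_preimage hA (measurable_capWeight_norm_sq l),
    ← hgm.measure_preimage (hA.inter hcap).nullMeasurableSet]
  simp only [LinearIsometryEquiv.norm_map]
  refine (setLIntegral_capWeight_le_volume_inter_sphericalCap l (hgm.measurable hA)
    (fun x hx t ht => ?_)).trans (measure_mono fun x hx => ⟨hx.1, ?_⟩)
  · rw [mem_preimage, map_add, map_smul, ← he, hg]
    exact hup _ hx t ht
  · refine ⟨by simpa using hx.2.1, ?_⟩
    rw [← hg, LinearIsometryEquiv.inner_map_map, he, EuclideanSpace.inner_single_right]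
    simpa using hx.2.2

/-! ### Partitions into cells -/

theorem volume_sphericalCap_le_of_partition {n : ℕ} (l : ℝ) {ι : Type*} [Countable ι]
    {A : ι → Set (EuclideanSpace ℝ (Fin (n + 1)))} (hA : ∀ i, MeasurableSet (A i))
    (hdisj : Pairwise (Function.onFun Disjoint A)) (hcover : ⋃ i, A i = univ)
    {ν : ι → EuclideanSpace ℝ (Fin (n + 1))} (hν : ∀ i, ‖ν i‖ = 1)
    (hup : ∀ i, ∀ x ∈ A i, ∀ t : ℝ, 0 ≤ t → x + t • ν i ∈ A i) :
    volume (sphericalCap n l) ≤ volume (⋃ i, A i ∩ {x | ‖x‖ < 1 ∧ l < inner ℝ x (ν i)}) := by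
  rw [← lintegral_capWeight_norm_sq, ← setLIntegral_univ, ← hcover,
    lintegral_iUnion hA hdisj, measure_iUnion]
  · exact ENNReal.tsum_le_tsum fun i =>
      setLIntegral_capWeight_le_volume_inter l (hA i) (hν i) (hup i)
  · exact fun i j hij => (hdisj hij).mono inter_subset_left inter_subset_left
  · exact fun i => (hA i).inter ((isOpen_lt (by fun_prop) (by fun_prop)).and
      (isOpen_lt (by fun_prop) (by fun_prop))).measurableSet

/-- The inequality for a finite set of points `p i`, values `c i` and normals `ν i`. The cell of `i`
consists of the `x` for which `i` is the first minimizer of `j ↦ c j - x · p j`. -/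
theorem volume_sphericalCap_le_of_finite {n : ℕ} (l : ℝ) {ι : Type*} [Fintype ι] [LinearOrder ι]
    [Nonempty ι] (p ν : ι → EuclideanSpace ℝ (Fin (n + 1))) (c : ι → ℝ) (hν : ∀ i, ‖ν i‖ = 1)
    (hpν : ∀ i j, inner ℝ (ν i) (p j - p i) ≤ 0) :
    volume (sphericalCap n l) ≤ volume {x | ‖x‖ < 1 ∧ ∃ i,
      (∀ j, inner ℝ x (p j - p i) ≤ c j - c i) ∧ l < inner ℝ x (ν i)} := by
  set A : ι → Set (EuclideanSpace ℝ (Fin (n + 1))) := fun i => {x | ∀ j,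
    inner ℝ x (p j - p i) ≤ c j - c i ∧ (j < i → inner ℝ x (p j - p i) < c j - c i)} with hA
  refine (volume_sphericalCap_le_of_partition l (A := A) (ν := ν) (fun i => ?_) ?_ ?_ hν ?_).trans
    (measure_mono ?_)
  · rw [hA]
    simp only [ofPred_forall, ofPred_and]
    exact MeasurableSet.iInter fun j => (measurableSet_le (by fun_prop) (by fun_prop)).inter
      (MeasurableSet.iInter fun _ => measurableSet_lt (by fun_prop) (by fun_prop))
  · have key : ∀ i j, i < j → Disjoint (A i) (A j) := fun i j hij => by
      refine Set.disjoint_left.2 fun x hi hj => ?_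
      have h1 := (hi j).1
      have h2 := (hj i).2 hij
      rw [inner_sub_right] at h1 h2
      linarith
    intro i j hij
    rcases lt_or_gt_of_ne hij with h | h
    exacts [key i j h, (key j i h).symm]
  · refine eq_univ_of_forall fun x => mem_iUnion.2 ?_
    -- minimize lexicographically: first the value, then the index
    obtain ⟨i, -, hi⟩ := Finset.exists_min_image Finset.univ
      (fun i => toLex (c i - inner ℝ x (p i), i)) Finset.univ_nonempty
    refine ⟨i, fun j => ?_⟩
    have h := hi j (Finset.mem_univ j)
    simp only [Prod.Lex.toLex_le_toLex] at h
    rw [inner_sub_right]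
    rcases h with h | ⟨h, h'⟩
    · exact ⟨by linarith, fun _ => by linarith⟩
    · exact ⟨by linarith, fun hlt => absurd h' (not_le.2 hlt)⟩
  · -- moving `x` by `t • ν i` lowers each `x · (p j - p i)`, hence preserves strict and weak bounds
    intro i x hx t ht j
    have h : inner ℝ (x + t • ν i) (p j - p i) ≤ inner ℝ x (p j - p i) := by
      rw [inner_add_left, real_inner_smul_left]
      nlinarith [hpν i j]
    exact ⟨h.trans (hx j).1, fun hlt => h.trans_lt ((hx j).2 hlt)⟩
  · refine iUnion_subset fun i x hx => ⟨hx.2.1, i, fun j => (hx.1 j).1, hx.2.2⟩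

/-! ### The outer unit normal -/

/-- A defining function near `x` also serves the boundary points near `x`: it vanishes there, since
`C` is a neighbourhood of every point at which it is negative. -/
theorem IsC1DefiningFunction.of_mem_frontier {N : ℕ} {C U : Set (EuclideanSpace ℝ (Fin N))}
    {x y : EuclideanSpace ℝ (Fin N)} {ρ : EuclideanSpace ℝ (Fin N) → ℝ}
    (h : IsC1DefiningFunction C x U ρ) (hC : IsClosed C) (hyU : y ∈ U) (hy : y ∈ frontier C)
    (hg : gradient ρ y ≠ 0) : IsC1DefiningFunction C y U ρ where
  isOpen := h.isOpen
  mem := hyU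
  contDiffOn := h.contDiffOn
  apply_eq_zero := by
    refine le_antisymm ((h.mem_iff y hyU).1 (hC.frontier_subset hy)) ?_
    by_contra! hneg
    have hcont : ContinuousAt ρ y := h.contDiffOn.continuousOn.continuousAt (h.isOpen.mem_nhds hyU)
    refine hy.2 (mem_interior_iff_mem_nhds.2 ?_)
    filter_upwards [hcont.eventually (gt_mem_nhds hneg), h.isOpen.mem_nhds hyU] with z hz hzU
    exact (h.mem_iff z hzU).2 hz.le
  gradient_ne_zero := hg
  mem_iff := h.mem_iff

theorem IsOfClassC1.isOuterUnitNormal {N : ℕ} {C : Set (EuclideanSpace ℝ (Fin N))}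
    (h : IsOfClassC1 C) {x : EuclideanSpace ℝ (Fin N)} (hx : x ∈ frontier C) :
    IsOuterUnitNormal C x (outerUnitNormal C x) := by
  obtain ⟨U, ρ, hρ⟩ := h x hx
  have hn : IsOuterUnitNormal C x (‖gradient ρ x‖⁻¹ • gradient ρ x) := ⟨U, ρ, hρ, rfl⟩
  rwa [hn.outerUnitNormal_eq]

theorem IsOuterUnitNormal.norm_eq_one {N : ℕ} {C : Set (EuclideanSpace ℝ (Fin N))}
    {x ν : EuclideanSpace ℝ (Fin N)} (h : IsOuterUnitNormal C x ν) : ‖ν‖ = 1 := by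
  obtain ⟨U, ρ, hρ, rfl⟩ := h
  exact norm_smul_inv_norm hρ.gradient_ne_zero

theorem IsOuterUnitNormal.inner_sub_nonpos {N : ℕ} {C : Set (EuclideanSpace ℝ (Fin N))}
    {x ν y : EuclideanSpace ℝ (Fin N)} (h : IsOuterUnitNormal C x ν) (hC : Convex ℝ C)
    (hx : x ∈ C) (hy : y ∈ C) : inner ℝ ν (y - x) ≤ 0 := by
  obtain ⟨U, ρ, hρ, rfl⟩ := h
  obtain ⟨hlim, hev⟩ := hρ.tendsto_slope (y - x)
  have hle : inner ℝ (gradient ρ x) (y - x) ≤ 0 := by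
    refine le_of_tendsto hlim ?_
    have h1 : ∀ᶠ t in 𝓝[>] (0 : ℝ), t < 1 :=
      (gt_mem_nhds one_pos).filter_mono nhdsWithin_le_nhds
    filter_upwards [hev, h1] with t ht ht1
    exact div_nonpos_of_nonpos_of_nonneg ((hρ.mem_iff _ ht.2).1
      (hC.add_smul_sub_mem hx hy ⟨ht.1.le, ht1.le⟩)) ht.1.le
  rw [real_inner_smul_left]
  exact mul_nonpos_of_nonneg_of_nonpos (by positivity) hle

theorem IsOfClassC1.continuousOn_outerUnitNormal {N : ℕ} {C : Set (EuclideanSpace ℝ (Fin N))}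
    (h : IsOfClassC1 C) (hC : IsClosed C) : ContinuousOn (outerUnitNormal C) (frontier C) := by
  intro x hx
  obtain ⟨U, ρ, hρ⟩ := h x hx
  have hU := hρ.isOpen.mem_nhds hρ.mem
  have hgrad : ContinuousAt (gradient ρ) x :=
    (InnerProductSpace.toDual ℝ (EuclideanSpace ℝ (Fin N))).symm.continuous.continuousAt.comp
      ((hρ.contDiffOn.continuousOn_fderiv_of_isOpen hρ.isOpen le_rfl).continuousAt hU)
  have hnormal : ContinuousAt (fun y => ‖gradient ρ y‖⁻¹ • gradient ρ y) x :=
    (hgrad.norm.inv₀ (norm_ne_zero_iff.2 hρ.gradient_ne_zero)).smul hgrad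
  have key : ∀ y ∈ U, y ∈ frontier C → gradient ρ y ≠ 0 →
      outerUnitNormal C y = ‖gradient ρ y‖⁻¹ • gradient ρ y := fun y hyU hy hg =>
    IsOuterUnitNormal.outerUnitNormal_eq ⟨U, ρ, hρ.of_mem_frontier hC hyU hy hg, rfl⟩
  refine hnormal.continuousWithinAt.congr_of_eventuallyEq ?_
    (key x hρ.mem hx hρ.gradient_ne_zero)
  filter_upwards [self_mem_nhdsWithin, nhdsWithin_le_nhds hU,
    nhdsWithin_le_nhds (hgrad.eventually_ne hρ.gradient_ne_zero)] with y hy hyU hg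
  exact key y hyU hy hg

/-! ### Approximate subgradients -/

/-- The `ξ` that are, up to an error `ε`, subgradients of `v` relative to `K` at some `x ∈ K` with
`ξ · ν(x) ≥ l`. The weak inequality makes this set closed. -/
def approxSubgradients {E : Type*} [NormedAddCommGroup E] [InnerProductSpace ℝ E] (K : Set E)
    (v : E → ℝ) (ν : E → E) (l ε : ℝ) : Set E :=
  {ξ | ∃ x ∈ K, l ≤ inner ℝ ξ (ν x) ∧ ∀ y ∈ K, inner ℝ ξ (y - x) ≤ v y - v x + ε}

section

variable {E : Type*} [NormedAddCommGroup E] [InnerProductSpace ℝ E] {K : Set E}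
  {v : E → ℝ} {ν : E → E} {l ε : ℝ}

/-- Closedness jointly in `ξ` and `ε`, by projection along the compact set `K`. -/
theorem isClosed_setOf_mem_approxSubgradients (hK : IsCompact K) (hv : ContinuousOn v K)
    (hν : ContinuousOn ν K) (l : ℝ) :
    IsClosed {p : E × ℝ | p.1 ∈ approxSubgradients K v ν l p.2} := by
  have := isCompact_iff_compactSpace.1 hK
  have hv' : Continuous fun x : K => v x := continuousOn_iff_continuous_domRestrict.1 hv
  have hν' : Continuous fun x : K => ν x := continuousOn_iff_continuous_domRestrict.1 hν
  have hcl : IsClosed {q : (E × ℝ) × K | l ≤ inner ℝ q.1.1 (ν q.2) ∧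
      ∀ y : K, inner ℝ q.1.1 ((y : E) - q.2) ≤ v y - v q.2 + q.1.2} := by
    have hvq : Continuous fun q : (E × ℝ) × K => v q.2 := hv'.comp continuous_snd
    have hνq : Continuous fun q : (E × ℝ) × K => ν q.2 := hν'.comp continuous_snd
    simp only [ofPred_and, ofPred_forall]
    exact (isClosed_le continuous_const (continuous_fst.fst.inner hνq)).inter
      (isClosed_iInter fun y => isClosed_le (by fun_prop)
        ((continuous_const.sub hvq).add continuous_fst.snd))
  convert isClosedMap_fst_of_compactSpace _ hcl
  ext p
  simp [approxSubgradients, and_left_comm]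

theorem isClosed_approxSubgradients (hK : IsCompact K) (hv : ContinuousOn v K)
    (hν : ContinuousOn ν K) : IsClosed (approxSubgradients K v ν l ε) :=
  (isClosed_setOf_mem_approxSubgradients hK hv hν l).preimage (f := fun ξ => (ξ, ε))
    (by fun_prop)

theorem approxSubgradients_mono {ε' : ℝ} (h : ε ≤ ε') :
    approxSubgradients K v ν l ε ⊆ approxSubgradients K v ν l ε' :=
  fun _ ⟨x, hx, hl, hy⟩ => ⟨x, hx, hl, fun y hyK => (hy y hyK).trans (by linarith)⟩

theorem iInter_approxSubgradients (hK : IsCompact K) (hv : ContinuousOn v K)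
    (hν : ContinuousOn ν K) :
    ⋂ k : ℕ, approxSubgradients K v ν l (1 / ((k : ℝ) + 1)) ⊆ approxSubgradients K v ν l 0 := by
  intro ξ hξ
  have hlim : Tendsto (fun k : ℕ => (ξ, 1 / ((k : ℝ) + 1))) atTop (𝓝 (ξ, (0 : ℝ))) :=
    tendsto_const_nhds.prodMk_nhds tendsto_one_div_add_atTop_nhds_zero_nat
  exact (isClosed_setOf_mem_approxSubgradients hK hv hν l).mem_of_tendsto hlim
    (Eventually.of_forall (mem_iInter.1 hξ))

end

/-! ### From finite sets to compact sets -/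

section

variable {n : ℕ} {K : Set (EuclideanSpace ℝ (Fin (n + 1)))} {v : EuclideanSpace ℝ (Fin (n + 1)) → ℝ}
  {ν : EuclideanSpace ℝ (Fin (n + 1)) → EuclideanSpace ℝ (Fin (n + 1))}

/-- A minimizer of `v - ξ · id` over a sufficiently fine finite net in `K` is a minimizer over `K`
up to `ε`, uniformly for `|ξ| < 1`. Hence the inequality for the net applies. -/
theorem volume_sphericalCap_le_approxSubgradients (hK : IsCompact K) (hKne : K.Nonempty)
    (hv : ContinuousOn v K) (hν1 : ∀ x ∈ K, ‖ν x‖ = 1)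
    (hνK : ∀ x ∈ K, ∀ y ∈ K, inner ℝ (ν x) (y - x) ≤ 0) (l : ℝ) {ε : ℝ} (hε : 0 < ε) :
    volume (sphericalCap n l) ≤ volume (Metric.ball 0 1 ∩ approxSubgradients K v ν l ε) := by
  obtain ⟨δ, hδ, hδv⟩ := Metric.uniformContinuousOn_iff.1
    (hK.uniformContinuousOn_of_continuous hv) (ε / 2) (half_pos hε)
  obtain ⟨t, htK, htfin, hcov⟩ := hK.finite_cover_balls (lt_min hδ (half_pos hε))
  obtain ⟨m, p, -, hp⟩ := htfin.fin_param
  have hpK : ∀ i, p i ∈ K := fun i => htK (hp ▸ mem_range_self i)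
  have hnet : ∀ y ∈ K, ∃ i, dist y (p i) < min δ (ε / 2) := fun y hy => by
    obtain ⟨z, hz, hyz⟩ := mem_iUnion₂.1 (hcov hy)
    obtain ⟨i, rfl⟩ : z ∈ range p := hp ▸ hz
    exact ⟨i, hyz⟩
  obtain ⟨y₀, hy₀⟩ := hKne
  have : Nonempty (Fin m) := (hnet y₀ hy₀).nonempty
  refine (volume_sphericalCap_le_of_finite l p (fun i => ν (p i)) (fun i => v (p i))
    (fun i => hν1 _ (hpK i)) (fun i j => hνK _ (hpK i) _ (hpK j))).trans (measure_mono ?_)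
  rintro ξ ⟨hξ, i, hi, hli⟩
  refine ⟨by simpa using hξ, p i, hpK i, hli.le, fun y hy => ?_⟩
  obtain ⟨j, hj⟩ := hnet y hy
  have h1 := (abs_lt.1 (hδv y hy (p j) (hpK j) (hj.trans_le (min_le_left _ _)))).1
  have h2 : inner ℝ ξ (y - p j) ≤ ε / 2 := by
    refine (real_inner_le_norm _ _).trans ?_
    rw [← dist_eq_norm]
    nlinarith [hj.trans_le (min_le_right _ _), norm_nonneg ξ, dist_nonneg (x := y) (y := p j)]
  have h3 : inner ℝ ξ (y - p i) = inner ℝ ξ (y - p j) + inner ℝ ξ (p j - p i) := by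
    rw [← inner_add_right, sub_add_sub_cancel]
  linarith [hi j]

theorem volume_sphericalCap_le_subgradients (hK : IsCompact K) (hKne : K.Nonempty)
    (hv : ContinuousOn v K) (hν : ContinuousOn ν K) (hν1 : ∀ x ∈ K, ‖ν x‖ = 1)
    (hνK : ∀ x ∈ K, ∀ y ∈ K, inner ℝ (ν x) (y - x) ≤ 0) (l : ℝ) :
    volume (sphericalCap n l) ≤ volume (Metric.ball 0 1 ∩ approxSubgradients K v ν l 0) := by
  set G : ℕ → Set (EuclideanSpace ℝ (Fin (n + 1))) := fun k =>
    Metric.ball 0 1 ∩ approxSubgradients K v ν l (1 / ((k : ℝ) + 1)) with hG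
  have hlim : Tendsto (volume ∘ G) atTop (𝓝 (volume (⋂ k, G k))) := by
    refine tendsto_measure_iInter_atTop (fun k => (measurableSet_ball.inter
      (isClosed_approxSubgradients hK hv hν).measurableSet).nullMeasurableSet) ?_ ⟨0, ?_⟩
    · exact fun j k hjk => inter_subset_inter_right _
        (approxSubgradients_mono (one_div_le_one_div_of_le (by positivity) (by gcongr)))
    · exact measure_ne_top_of_subset inter_subset_left measure_ball_lt_top.ne
  refine (ge_of_tendsto' hlim fun k => volume_sphericalCap_le_approxSubgradients hK hKne hv hν1
    hνK l (by positivity)).trans (measure_mono ?_)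
  rw [hG, ← inter_iInter]
  exact inter_subset_inter_right _ (iInter_approxSubgradients hK hv hν)

theorem restrictedSubgradients_eq_iUnion (C K : Set (EuclideanSpace ℝ (Fin (n + 1))))
    (v : EuclideanSpace ℝ (Fin (n + 1)) → ℝ) (l : ℝ) :
    restrictedSubgradients C K v l = ⋃ k : ℕ, Metric.ball 0 1 ∩
      approxSubgradients K v (outerUnitNormal C) (l + 1 / ((k : ℝ) + 1)) 0 := by
  ext ξ
  simp only [restrictedSubgradients, restrictedSubdifferential, approxSubgradients, mem_iUnion,
    mem_ofPred_eq, mem_inter_iff, mem_ball_zero_iff, add_zero, exists_prop]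
  constructor
  · rintro ⟨x, hx, hJ, h1, hl⟩
    obtain ⟨k, hk⟩ := exists_nat_one_div_lt (sub_pos.2 hl)
    exact ⟨k, h1, x, hx, by linarith, hJ⟩
  · rintro ⟨k, h1, x, hx, hl, hJ⟩
    have : 0 < 1 / ((k : ℝ) + 1) := by positivity
    exact ⟨x, hx, hJ, h1, by linarith⟩

theorem iUnion_sphericalCap (n : ℕ) (l : ℝ) :
    ⋃ k : ℕ, sphericalCap n (l + 1 / ((k : ℝ) + 1)) = sphericalCap n l := by
  ext ξ
  simp only [sphericalCap, mem_iUnion, mem_ofPred_eq, exists_and_left]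
  refine and_congr_right fun _ => ⟨?_, fun hl => ?_⟩
  · rintro ⟨k, hk⟩
    have : 0 < 1 / ((k : ℝ) + 1) := by positivity
    linarith
  · obtain ⟨k, hk⟩ := exists_nat_one_div_lt (sub_pos.2 hl)
    exact ⟨k, by linarith⟩

end

theorem theorem3p1 (n : ℕ) (l : ℝ) (hl : l ∈ Set.Ioo (-1 : ℝ) 1)
    (C : Set (EuclideanSpace ℝ (Fin (n + 1)))) (hC_closed : IsClosed C) (hC_convex : Convex ℝ C)
    (hC_int : (interior C).Nonempty) (hC_C1 : IsOfClassC1 C)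
    (K : Set (EuclideanSpace ℝ (Fin (n + 1)))) (hK_sub : K ⊆ frontier C) (hK_compact : IsCompact K)
    (hK_ne : K.Nonempty)
    (v : EuclideanSpace ℝ (Fin (n + 1)) → ℝ) (hv : ContinuousOn v K) :
    MeasurableSet (restrictedSubgradients C K v l) ∧
      MeasureTheory.volume (sphericalCap n l) ≤
        MeasureTheory.volume (restrictedSubgradients C K v l) := by
  have hν : ContinuousOn (outerUnitNormal C) K :=
    (hC_C1.continuousOn_outerUnitNormal hC_closed).mono hK_sub
  have hKC : K ⊆ C := hK_sub.trans hC_closed.frontier_subset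
  have hnormal := fun x (hx : x ∈ K) => hC_C1.isOuterUnitNormal (hK_sub hx)
  constructor
  · rw [restrictedSubgradients_eq_iUnion]
    exact MeasurableSet.iUnion fun k => measurableSet_ball.inter
      (isClosed_approxSubgradients hK_compact hv hν).measurableSet
  · have hmono : Monotone fun k : ℕ => sphericalCap n (l + 1 / ((k : ℝ) + 1)) := by
      refine fun j k hjk ξ hξ => ⟨hξ.1, lt_of_le_of_lt ?_ hξ.2⟩
      have : 1 / ((k : ℝ) + 1) ≤ 1 / ((j : ℝ) + 1) :=
        one_div_le_one_div_of_le (by positivity) (by gcongr)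
      linarith
    rw [← iUnion_sphericalCap, hmono.measure_iUnion, restrictedSubgradients_eq_iUnion]
    refine iSup_le fun k => (volume_sphericalCap_le_subgradients hK_compact hK_ne hv hν
      (fun x hx => (hnormal x hx).norm_eq_one) (fun x hx y hy => ?_) _).trans
      (measure_mono (subset_iUnion (fun k : ℕ => Metric.ball 0 1 ∩
        approxSubgradients K v (outerUnitNormal C) (l + 1 / ((k : ℝ) + 1)) 0) k))
    exact (hnormal x hx).inner_sub_nonpos hC_convex (hKC hx) (hKC hy)
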